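/- Let $N\ge 1$ be an integer and $s\in(0,1)$ with $N>2s$; put $2^*_s=\frac{2N}{N-2s}$. Let $$D^{s,2}(\mathbb{R}^N)=\Big\{u\in L^{2^*_s}(\mathbb{R}^N):\ \|u\|_{D^{s,2}(\mathbb{R}^N)}^2:=\int_{\mathbb{R}^N}\int_{\mathbb{R}^N}\frac{(u(x)-u(y))^2}{|x-y|^{N+2s}}\,dx\,dy<\infty\Big\}$$ (real-valued functions). Let $R>0$ and let $B_R$ be the open ball of radius $R$ centred at the origin of $\mathbb{R}^N$. Suppose that $u\in D^{s,2}(\mathbb{R}^N)$ satisfies $u=0$ a.e. in $B_R$. Then there exists a sequence $(\phi_n)\subset C_c^\infty(\mathbb{R}^N\setminus\overline{B}_R)$ (smooth functions with compact support contained in $\mathbb{R}^N\setminus\overline{B}_R$), with $\phi_n\in D^{s,2}(\mathbb{R}^N)$ for every $n$, such that $\|\phi_n-u\|_{D^{s,2}(\mathbb{R}^N)}\to 0$ as $n\to\infty$. Moreover, if $u\ge 0$ a.e. in $\mathbb{R}^N$, the sequence can be chosen so that in addition $\phi_n\ge 0$ for every $n$. -/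

import Mathlib

open MeasureTheory Metric Filter Topology
open scoped ENNReal

/-- The fractional critical Sobolev exponent `2N / (N - 2s)`; it is used only for `2s < N`. -/
noncomputable def fracCritExp (N : ℕ) (s : ℝ) : ℝ≥0∞ :=
  ENNReal.ofReal (2 * (N : ℝ) / ((N : ℝ) - 2 * s))

/-- The squared Gagliardo seminorm `∫∫ (u x - u y)² / |x - y|^(N + 2s) dx dy`, as an extended
nonnegative number (so that divergence is recorded as `∞`). The integrand on the diagonal
is `0 / 0 = 0`. -/
noncomputable def gagliardoEnergy {N : ℕ} (s : ℝ) (u : EuclideanSpace ℝ (Fin N) → ℝ) : ℝ≥0∞ :=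
  ∫⁻ y, ∫⁻ x, ENNReal.ofReal ((u x - u y) ^ 2 / ‖x - y‖ ^ ((N : ℝ) + 2 * s))

/-- The norm of the homogeneous fractional Sobolev space, the square root of
`gagliardoEnergy`. -/
noncomputable def fracNorm {N : ℕ} (s : ℝ) (u : EuclideanSpace ℝ (Fin N) → ℝ) : ℝ≥0∞ :=
  gagliardoEnergy s u ^ (1 / 2 : ℝ)

/-- Membership in the homogeneous fractional Sobolev space: `u` lies in `L^{2N/(N-2s)}`
and its Gagliardo energy is finite. -/
def MemFracSobolev {N : ℕ} (s : ℝ) (u : EuclideanSpace ℝ (Fin N) → ℝ) : Prop :=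
  MemLp u (fracCritExp N s) volume ∧ gagliardoEnergy s u < ∞

/-- The open complement of the closed ball of radius `R` centred at the origin. -/
def ballExterior (N : ℕ) (R : ℝ) : TopologicalSpace.Opens (EuclideanSpace ℝ (Fin N)) :=
  ⟨(closedBall 0 R)ᶜ, isClosed_closedBall.isOpen_compl⟩

/-! The Gagliardo seminorm of `u` is the `L²` norm on pairs of points of the quotient `fracQuot s
u`, which is linear in `u`, so every approximation becomes an `L²` convergence. Four operations,
each preserving nonnegativity, lead from `u` to a test function.

Clipping away values of size at most `e` leaves a function supported on a set of finite measure,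
hence in `L²`; the critical exponent enters only through `2 ≤ q < ∞`. Dilating, `x ↦ u (c x)` with
`c < 1`, enlarges the ball of zeros, so no regularity of `u` at the sphere is needed; the quotient
is itself only dilated and multiplied by a power of `c`. Cutting off at infinity produces a cross
term `u(y)(η(x) - η(y))`, controlled by `u ∈ L²` and `lintegral_min_sq_div_rpow_ne_top`. Mollifying
averages the quotient over diagonal translations, so `eLpNorm_two_integral_le` applies. Dilations
and translations are both handled by `tendsto_eLpNorm_comp_affine_sub`. -/

/-! ### Convergence in `L²` and integrability of the kernel -/

theorem eLpNorm_two_sq {α : Type*} [MeasurableSpace α] {μ : Measure α} (f : α → ℝ) :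
    eLpNorm f 2 μ ^ 2 = ∫⁻ a, ‖f a‖ₑ ^ 2 ∂μ := by
  have := eLpNorm_nnreal_pow_eq_lintegral (f := f) (μ := μ) (p := 2) (by norm_num)
  simpa using this

/-- Domination is asked of the square, so that bounds of the form `2a² + 2b²` can be used directly.
-/
theorem tendsto_eLpNorm_two_of_dominated {α ι : Type*} [MeasurableSpace α] {μ : Measure α}
    {l : Filter ι} [l.IsCountablyGenerated] {F : ι → α → ℝ} (bound : α → ℝ≥0∞)
    (hF : ∀ᶠ i in l, AEStronglyMeasurable (F i) μ)
    (hb : ∀ᶠ i in l, ∀ᵐ a ∂μ, ‖F i a‖ₑ ^ 2 ≤ bound a) (hfin : ∫⁻ a, bound a ∂μ ≠ ∞)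
    (hlim : ∀ᵐ a ∂μ, Tendsto (fun i => F i a) l (𝓝 0)) :
    Tendsto (fun i => eLpNorm (F i) 2 μ) l (𝓝 0) := by
  have h : Tendsto (fun i => ∫⁻ a, ‖F i a‖ₑ ^ 2 ∂μ) l (𝓝 (∫⁻ _, 0 ∂μ)) := by
    refine tendsto_lintegral_filter_of_dominated_convergence' bound ?_ hb hfin ?_
    · filter_upwards [hF] with i hi using hi.enorm.pow_const 2
    · filter_upwards [hlim] with a ha
      have := (ENNReal.continuous_pow 2).tendsto _ |>.comp ha.enorm
      simpa [Function.comp_def] using this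
  simp only [lintegral_zero, ← eLpNorm_two_sq] at h
  have h2 := (ENNReal.continuous_rpow_const (y := (1 / 2 : ℝ))).tendsto _ |>.comp h
  have e : ∀ x : ℝ≥0∞, (x ^ 2) ^ (1 / 2 : ℝ) = x := fun x => by
    rw [← ENNReal.rpow_natCast, ← ENNReal.rpow_mul]; norm_num
  simpa [Function.comp_def, -one_div, e] using h2

/-- `L²` continuity of composition with affine maps close to the identity. -/
theorem tendsto_eLpNorm_comp_affine_sub {X ι : Type*} [NormedAddCommGroup X] [NormedSpace ℝ X]
    [FiniteDimensional ℝ X] [MeasurableSpace X] [BorelSpace X] {μ : Measure X}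
    [μ.IsAddHaarMeasure] {l : Filter ι} [l.IsCountablyGenerated] {c : ι → ℝ} {a : ι → X}
    (hc : Tendsto c l (𝓝 1)) (ha : Tendsto a l (𝓝 0)) {f : X → ℝ} (hf : MemLp f 2 μ) :
    Tendsto (fun i => eLpNorm (fun x => f (c i • x + a i) - f x) 2 μ) l (𝓝 0) := by
  have : ProperSpace X := FiniteDimensional.proper_real X
  have hmap : ∀ (r : ℝ) (b : X), r ≠ 0 →
      μ.map (fun x => r • x + b) = ENNReal.ofReal |(r ^ Module.finrank ℝ X)⁻¹| • μ := by
    intro r b hr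
    have : (fun x : X => r • x + b) = (fun x => x + b) ∘ (fun x => r • x) := rfl
    rw [this, ← Measure.map_map (by fun_prop) (by fun_prop), Measure.map_addHaar_smul μ hr,
      Measure.map_smul, map_add_right_eq_self]
  have hnorm : ∀ (r : ℝ) (b : X) (g : X → ℝ), r ≠ 0 → AEStronglyMeasurable g μ →
      eLpNorm (fun x => g (r • x + b)) 2 μ
        = ENNReal.ofReal |(r ^ Module.finrank ℝ X)⁻¹| ^ (1 / 2 : ℝ) * eLpNorm g 2 μ := by
    intro r b g hr hg
    have h1 : AEStronglyMeasurable g (μ.map (fun x => r • x + b)) := by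
      rw [hmap r b hr]; exact hg.smul_measure _
    have := eLpNorm_map_measure (p := 2) h1 (f := fun x => r • x + b) (by fun_prop)
    rw [show (fun x => g (r • x + b)) = g ∘ (fun x => r • x + b) from rfl, ← this, hmap r b hr,
      eLpNorm_smul_measure_of_ne_top (by simp)]
    simp
  have hmeas : ∀ (r : ℝ) (b : X) (g : X → ℝ), r ≠ 0 → AEStronglyMeasurable g μ →
      AEStronglyMeasurable (fun x => g (r • x + b)) μ := by
    intro r b g hr hg
    have h1 : AEStronglyMeasurable g (μ.map (fun x => r • x + b)) := by
      rw [hmap r b hr]; exact hg.smul_measure _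
    exact h1.comp_aemeasurable (by fun_prop)
  have hK : ∀ᶠ i in l, c i ≠ 0 ∧ 1 / 2 < c i ∧
      ENNReal.ofReal |((c i) ^ Module.finrank ℝ X)⁻¹| ^ (1 / 2 : ℝ) ≤ 2 := by
    have h1 : Tendsto (fun i => ENNReal.ofReal |((c i) ^ Module.finrank ℝ X)⁻¹| ^ (1 / 2 : ℝ)) l
        (𝓝 1) := by
      have h0 : Tendsto (fun i => |((c i) ^ Module.finrank ℝ X)⁻¹|) l (𝓝 1) := by
        simpa using ((hc.pow (Module.finrank ℝ X)).inv₀ (by simp)).abs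
      have := (ENNReal.continuous_rpow_const (y := (1 / 2 : ℝ))).tendsto _ |>.comp
        (ENNReal.tendsto_ofReal h0)
      simpa [Function.comp_def] using this
    filter_upwards [hc.eventually_ne one_ne_zero, hc.eventually_const_lt (by norm_num : (1/2:ℝ) < 1),
      h1.eventually_le_const (by norm_num : (1 : ℝ≥0∞) < 2)] with i a b c using ⟨a, b, c⟩
  rw [ENNReal.tendsto_nhds_zero]
  intro ε hε
  obtain ⟨g, hgs, hfg, hgc, hgm⟩ := hf.exists_hasCompactSupport_eLpNorm_sub_le (by simp)
    (ε := ε / 4) (by simpa using hε.ne')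
  have hg0 : Tendsto (fun i => eLpNorm (fun x => g (c i • x + a i) - g x) 2 μ) l (𝓝 0) := by
    obtain ⟨C, hC⟩ := hgc.bounded_above_of_compact_support hgs
    obtain ⟨M, hM⟩ := hgs.isCompact.isBounded.subset_closedBall 0
    have hz : ∀ x, M < ‖x‖ → g x = 0 := fun x hx => by
      by_contra h
      have := hM (subset_tsupport g h)
      simp at this; linarith
    -- If `‖x‖ > 2(|M| + 1)`, `c > 1/2` and `‖a‖ < 1`, then `‖c x + a‖ > |M|`, so both terms vanish.
    refine tendsto_eLpNorm_two_of_dominated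
      ((closedBall (0 : X) (2 * (|M| + 1))).indicator fun _ => (ENNReal.ofReal (2 * C)) ^ 2)
      (Eventually.of_forall fun i => ?_) ?_ ?_ (Eventually.of_forall fun x => ?_)
    · exact (by fun_prop : Continuous fun x => g (c i • x + a i) - g x).aestronglyMeasurable
    · filter_upwards [hK, ha.norm.eventually_lt_const (by simp : ‖(0 : X)‖ < 1)] with i hi hai
      refine Eventually.of_forall fun x => ?_
      by_cases hx : x ∈ closedBall (0 : X) (2 * (|M| + 1))
      · rw [Set.indicator_of_mem hx]
        gcongr
        rw [← ofReal_norm]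
        refine ENNReal.ofReal_le_ofReal ((norm_sub_le _ _).trans ?_)
        linarith [hC (c i • x + a i), hC x]
      · rw [Set.indicator_of_notMem hx]
        simp only [mem_closedBall, dist_zero_right, not_le] at hx
        have h1 := le_abs_self M
        have h2 := abs_nonneg M
        have h3 : ‖c i • x‖ ≤ ‖c i • x + a i‖ + ‖a i‖ := by
          simpa using norm_sub_le (c i • x + a i) (a i)
        rw [norm_smul, Real.norm_eq_abs, abs_of_pos (by linarith [hi.2.1])] at h3
        rw [hz x (by linarith), hz (c i • x + a i) (by nlinarith [hi.2.1])]
        simp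
    · rw [lintegral_indicator measurableSet_closedBall, setLIntegral_const]
      exact ENNReal.mul_ne_top (by finiteness) (isCompact_closedBall _ _).measure_lt_top.ne
    · have h1 : Tendsto (fun i => c i • x + a i) l (𝓝 x) := by
        simpa using (hc.smul_const x).add ha
      simpa using ((hgc.tendsto x).comp h1).sub_const (g x)
  rw [ENNReal.tendsto_nhds_zero] at hg0
  filter_upwards [hK, hg0 (ε / 4) (by simpa using hε.ne')] with i hi hgi
  have hd : AEStronglyMeasurable (f - g) μ := hf.1.sub hgm.1
  have e : (fun x => f (c i • x + a i) - f x) = (fun x => (f - g) (c i • x + a i)) +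
      ((fun x => g (c i • x + a i) - g x) + (g - f)) := by
    ext x; simp
  rw [e]
  have hgd : AEStronglyMeasurable (fun x => g (c i • x + a i) - g x) μ :=
    (by fun_prop : Continuous fun x => g (c i • x + a i) - g x).aestronglyMeasurable
  have hgf : AEStronglyMeasurable (g - f) μ := hgm.1.sub hf.1
  calc _ ≤ eLpNorm (fun x => (f - g) (c i • x + a i)) 2 μ +
        (eLpNorm (fun x => g (c i • x + a i) - g x) 2 μ + eLpNorm (g - f) 2 μ) :=
        (eLpNorm_add_le (hmeas _ _ _ hi.1 hd) (hgd.add hgf) (by norm_num)).trans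
          (by gcongr; exact eLpNorm_add_le hgd hgf (by norm_num))
    _ ≤ 2 * (ε / 4) + (ε / 4 + ε / 4) := by
        rw [hnorm _ _ _ hi.1 hd, eLpNorm_sub_comm g f]
        gcongr
        exact hi.2.2
    _ = 4 * (ε / 4) := by ring
    _ ≤ ε := by rw [ENNReal.mul_div_cancel (by norm_num) (by norm_num)]

/-- A form of Minkowski's integral inequality for averages over a probability measure. -/
theorem eLpNorm_two_integral_le {X Y : Type*} [MeasurableSpace X] [MeasurableSpace Y]
    {μ : Measure X} {ν : Measure Y} [SFinite μ] [IsProbabilityMeasure ν] {G : X → Y → ℝ}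
    (hG : Measurable (Function.uncurry G)) {ε : ℝ≥0∞}
    (hε : ∀ᵐ h ∂ν, eLpNorm (fun x => G x h) 2 μ ≤ ε) :
    eLpNorm (fun x => ∫ h, G x h ∂ν) 2 μ ≤ ε := by
  rw [← ENNReal.pow_le_pow_left_iff two_ne_zero]
  rw [eLpNorm_two_sq]
  -- `‖·‖₁ ≤ ‖·‖₂` on a probability space for each `x`, then Tonelli.
  calc ∫⁻ x, ‖∫ h, G x h ∂ν‖ₑ ^ 2 ∂μ ≤ ∫⁻ x, ∫⁻ h, ‖G x h‖ₑ ^ 2 ∂ν ∂μ := by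
        refine lintegral_mono fun x => ?_
        have hm : Measurable (G x) := hG.comp (measurable_const.prodMk measurable_id)
        rw [← eLpNorm_two_sq]
        gcongr
        refine (enorm_integral_le_lintegral_enorm _).trans ?_
        rw [← eLpNorm_one_eq_lintegral_enorm]
        exact eLpNorm_le_eLpNorm_of_exponent_le (by norm_num) hm.aestronglyMeasurable
    _ = ∫⁻ h, ∫⁻ x, ‖G x h‖ₑ ^ 2 ∂μ ∂ν :=
        lintegral_lintegral_swap (hG.enorm.pow_const 2).aemeasurable
    _ ≤ ∫⁻ h, ε ^ 2 ∂ν := by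
        refine lintegral_mono_ae ?_
        filter_upwards [hε] with h hh
        rw [← eLpNorm_two_sq]
        gcongr
    _ = ε ^ 2 := by simp

/-- In polar coordinates the integrand is `r ^ (1 - 2s)` up to radius 1, integrable as `s < 1`, and
`r ^ (-1 - 2s)` beyond, integrable as `s > 0`. -/
theorem lintegral_min_sq_div_rpow_ne_top {N : ℕ} {s : ℝ} (hN : 0 < N) (hs0 : 0 < s) (hs1 : s < 1) :
    ∫⁻ z : EuclideanSpace ℝ (Fin N),
      ENNReal.ofReal (min 1 ‖z‖ ^ 2 / ‖z‖ ^ ((N : ℝ) + 2 * s)) ≠ ∞ := by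
  have : Nonempty (Fin N) := ⟨⟨0, hN⟩⟩
  have hint : Integrable (fun z : EuclideanSpace ℝ (Fin N) =>
      (fun r : ℝ => min 1 r ^ 2 / r ^ ((N : ℝ) + 2 * s)) ‖z‖) := by
    refine (integrable_fun_norm_addHaar volume
      (f := fun r : ℝ => min 1 r ^ 2 / r ^ ((N : ℝ) + 2 * s))).2 ?_
    rw [← Set.Ioc_union_Ioi_eq_Ioi (zero_le_one' ℝ)]
    have hpow : ∀ y : ℝ, 0 < y → y ^ (N - 1) = y ^ ((N : ℝ) - 1) := fun y hy => by
      rw [← Real.rpow_natCast, Nat.cast_pred hN]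
    simp only [finrank_euclideanSpace, Fintype.card_fin, smul_eq_mul]
    refine IntegrableOn.union ?_ ?_
    · have h1 : IntegrableOn (fun y : ℝ => y ^ (1 - 2 * s)) (Set.Ioc 0 1) :=
        (intervalIntegrable_iff_integrableOn_Ioc_of_le zero_le_one).1
          (intervalIntegral.intervalIntegrable_rpow' (by linarith))
      refine h1.congr_fun (fun y hy => ?_) measurableSet_Ioc
      dsimp only
      rw [min_eq_right hy.2, hpow y hy.1, ← Real.rpow_natCast y 2, ← Real.rpow_sub hy.1,
        ← Real.rpow_add hy.1]
      congr 1; push_cast; ring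
    · have h1 : IntegrableOn (fun y : ℝ => y ^ (-1 - 2 * s)) (Set.Ioi 1) :=
        integrableOn_Ioi_rpow_of_lt (by linarith) one_pos
      refine h1.congr_fun (fun y hy => ?_) measurableSet_Ioi
      have hy : 1 < y := hy
      dsimp only
      rw [min_eq_left hy.le, hpow y (by linarith), one_pow, one_div,
        ← Real.rpow_neg (by linarith), ← Real.rpow_add (by linarith)]
      congr 1; ring
  have h2 := hint.lintegral_lt_top
  exact h2.ne

/-! ### The Gagliardo seminorm as an `L²` norm -/

/-- The fractional difference quotient, whose `L²` norm is the Gagliardo seminorm. -/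
noncomputable def fracQuot {N : ℕ} (s : ℝ) (u : EuclideanSpace ℝ (Fin N) → ℝ)
    (p : EuclideanSpace ℝ (Fin N) × EuclideanSpace ℝ (Fin N)) : ℝ :=
  (u p.1 - u p.2) / ‖p.1 - p.2‖ ^ (((N : ℝ) + 2 * s) / 2)

section

variable {N : ℕ} {s : ℝ} {u v w : EuclideanSpace ℝ (Fin N) → ℝ}

instance isAddHaarMeasure_volume_prod : (volume :
    Measure (EuclideanSpace ℝ (Fin N) × EuclideanSpace ℝ (Fin N))).IsAddHaarMeasure :=
  inferInstanceAs ((volume.prod volume).IsAddHaarMeasure)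

theorem rpow_half_sq {t : ℝ} (ht : 0 ≤ t) (a : ℝ) : (t ^ (a / 2)) ^ 2 = t ^ a := by
  rw [← Real.rpow_natCast, ← Real.rpow_mul ht]; norm_num

theorem measurable_fracQuot (hu : Measurable u) : Measurable (fracQuot s u) := by
  unfold fracQuot; fun_prop

theorem fracQuot_sub (p : EuclideanSpace ℝ (Fin N) × EuclideanSpace ℝ (Fin N)) :
    fracQuot s (fun x => u x - v x) p = fracQuot s u p - fracQuot s v p := by
  unfold fracQuot; ring

theorem gagliardoEnergy_eq (hu : Measurable u) :
    gagliardoEnergy s u = eLpNorm (fracQuot s u) 2 volume ^ 2 := by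
  rw [eLpNorm_two_sq, Measure.volume_eq_prod,
    lintegral_prod_symm' _ ((measurable_fracQuot hu).enorm.pow_const 2)]
  refine lintegral_congr fun y => lintegral_congr fun x => ?_
  rw [← Real.enorm_abs, ← ofReal_norm, ← ENNReal.ofReal_pow (norm_nonneg _)]
  congr 1
  simp only [fracQuot, Real.norm_eq_abs, abs_abs, sq_abs, div_pow]
  rw [rpow_half_sq (norm_nonneg _)]

theorem fracNorm_eq (hu : Measurable u) : fracNorm s u = eLpNorm (fracQuot s u) 2 volume := by
  rw [fracNorm, gagliardoEnergy_eq hu, ← ENNReal.rpow_natCast, ← ENNReal.rpow_mul]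
  norm_num

theorem gagliardoEnergy_congr_ae (h : u =ᵐ[volume] v) :
    gagliardoEnergy s u = gagliardoEnergy s v := by
  refine lintegral_congr_ae ?_
  filter_upwards [h] with y hy
  refine lintegral_congr_ae ?_
  filter_upwards [h] with x hx
  rw [hx, hy]

theorem fracNorm_congr_ae (h : u =ᵐ[volume] v) : fracNorm s u = fracNorm s v := by
  rw [fracNorm, gagliardoEnergy_congr_ae h, fracNorm]

theorem memLp_fracQuot_iff (hu : Measurable u) :
    MemLp (fracQuot s u) 2 volume ↔ gagliardoEnergy s u < ∞ := by
  rw [gagliardoEnergy_eq hu, ENNReal.pow_lt_top_iff]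
  simp [MemLp, (measurable_fracQuot hu).aestronglyMeasurable]

theorem fracNorm_sub_le (hu : Measurable u) (hv : Measurable v) (hw : Measurable w) :
    fracNorm s (fun x => u x - w x) ≤
      fracNorm s (fun x => u x - v x) + fracNorm s (fun x => v x - w x) := by
  rw [fracNorm_eq (hu.fun_sub hw), fracNorm_eq (hu.fun_sub hv), fracNorm_eq (hv.fun_sub hw)]
  have e : fracQuot s (fun x => u x - w x) =
      fracQuot s (fun x => u x - v x) + fracQuot s (fun x => v x - w x) := by
    ext p; simp only [Pi.add_apply, fracQuot_sub]; ring
  rw [e]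
  exact eLpNorm_add_le (measurable_fracQuot (hu.fun_sub hv)).aestronglyMeasurable
    (measurable_fracQuot (hv.fun_sub hw)).aestronglyMeasurable (by norm_num)

/-! ### Successive reductions to test functions -/

/-- `u` can be approximated in the Gagliardo seminorm by test functions supported outside the
closed ball of radius `R`, which are nonnegative if `u` is. -/
def FracApproximable (s R : ℝ) (u : EuclideanSpace ℝ (Fin N) → ℝ) : Prop :=
  ∀ ε : ℝ≥0∞, 0 < ε → ∃ φ : TestFunction (ballExterior N R) ℝ (⊤ : ℕ∞),
    fracNorm s (fun x => φ x - u x) ≤ ε ∧ ((∀ x, 0 ≤ u x) → ∀ x, 0 ≤ φ x)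

/-- The triangle inequality makes approximability a closed condition. It is asked of `v n` only
eventually, since finiteness of the norms of `v n` may come from the convergence itself. -/
theorem FracApproximable.of_tendsto {R : ℝ} (hu : Measurable u)
    {v : ℕ → EuclideanSpace ℝ (Fin N) → ℝ} (hv : ∀ n, Measurable (v n))
    (hvR : ∀ᶠ n in atTop, FracApproximable s R (v n))
    (hpos : (∀ x, 0 ≤ u x) → ∀ n x, 0 ≤ v n x)
    (hlim : Tendsto (fun n => fracNorm s (fun x => v n x - u x)) atTop (𝓝 0)) :
    FracApproximable s R u := by
  intro ε hε
  have hε2 : 0 < ε / 2 := ENNReal.half_pos hε.ne'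
  obtain ⟨n, hn, hnR⟩ := ((ENNReal.tendsto_nhds_zero.1 hlim _ hε2).and hvR).exists
  obtain ⟨φ, hφ, hφ0⟩ := hnR _ hε2
  refine ⟨φ, ?_, fun h => hφ0 (hpos h n)⟩
  refine (fracNorm_sub_le φ.continuous.measurable (hv n) hu).trans ?_
  calc _ ≤ ε / 2 + ε / 2 := by gcongr
    _ = ε := ENNReal.add_halves ε

/-- Mollification. -/
theorem fracApproximable_of_compactSupport {R R' M : ℝ} (hR : R < R') (hu : Measurable u)
    (hu2 : MemLp u 2 volume) (hE : MemLp (fracQuot s u) 2 volume)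
    (hu0 : ∀ x, ‖x‖ < R' → u x = 0) (huM : ∀ x, M < ‖x‖ → u x = 0) :
    FracApproximable s R u := by
  intro ε hε
  -- Moving both points by the same `-h` leaves their distance unchanged, so it turns the quotient
  -- of `u` into that of its translate.
  have hcont := tendsto_eLpNorm_comp_affine_sub (l := 𝓝 (0 : EuclideanSpace ℝ (Fin N)))
    (c := fun _ => (1 : ℝ)) (a := fun h => (-h, -h)) tendsto_const_nhds
    ((by fun_prop : Continuous fun h : EuclideanSpace ℝ (Fin N) => (-h, -h)).tendsto' 0 0
      (by simp)) hE
  obtain ⟨δ₀, hδ₀, hball⟩ := Metric.eventually_nhds_iff_ball.1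
    (ENNReal.tendsto_nhds_zero.1 hcont ε hε)
  -- The second bound gives `R' - δ > R`, which keeps the support of `φ` off the closed ball.
  set δ := min δ₀ ((R' - R) / 2) with hδdef
  have hδ : 0 < δ := lt_min hδ₀ (by linarith)
  let b : ContDiffBump (0 : EuclideanSpace ℝ (Fin N)) := ⟨δ / 2, δ, by linarith, by linarith⟩
  set ρ : EuclideanSpace ℝ (Fin N) → ℝ := b.normed volume with hρ
  have hρ0 : ∀ h, 0 ≤ ρ h := fun h => b.nonneg_normed h
  have hρc : Continuous ρ := b.continuous_normed
  have hρi : Integrable ρ volume := b.integrable_normed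
  have hρs : ∀ h, ρ h ≠ 0 → ‖h‖ < δ := fun h hh => by
    have : h ∈ Function.support ρ := hh
    rw [hρ, b.support_normed_eq] at this
    simpa using this
  have hloc : LocallyIntegrable u volume := hu2.locallyIntegrable (by norm_num)
  have hex : ∀ x, Integrable (fun h => ρ h • u (x - h)) volume := fun x =>
    b.hasCompactSupport_normed.convolutionExists_left (ContinuousLinearMap.lsmul ℝ ℝ) hρc hloc x
  set φ : EuclideanSpace ℝ (Fin N) → ℝ := fun x => ∫ h, ρ h • u (x - h) with hφ
  have hφs : ContDiff ℝ (⊤ : ℕ∞) φ :=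
    b.hasCompactSupport_normed.contDiff_convolution_left (ContinuousLinearMap.lsmul ℝ ℝ)
      (b.contDiff_normed (n := (⊤ : ℕ∞))) hloc
  have hφz : ∀ x, (∀ h, ‖h‖ < δ → u (x - h) = 0) → φ x = 0 := fun x hx => by
    simp only [hφ]
    refine integral_eq_zero_of_ae (Eventually.of_forall fun h => ?_)
    by_cases hh : ρ h = 0
    · simp [hh]
    · simp [hx h (hρs h hh)]
  have hφc : HasCompactSupport φ := by
    refine HasCompactSupport.intro (isCompact_closedBall 0 (M + δ)) fun x hx => hφz x fun h hh => ?_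
    simp only [mem_closedBall, dist_zero_right, not_le] at hx
    have := norm_sub_norm_le x h
    exact huM _ (by linarith)
  have hφt : tsupport φ ⊆ ballExterior N R := by
    have h1 : tsupport φ ⊆ (ball 0 (R' - δ))ᶜ := by
      refine closure_minimal (fun x hx => ?_) isOpen_ball.isClosed_compl
      intro hxb
      refine hx (hφz x fun h hh => hu0 _ ?_)
      have := norm_sub_le x h
      simp only [mem_ball, dist_zero_right] at hxb
      linarith
    refine h1.trans fun x hx => ?_
    change x ∈ (closedBall 0 R)ᶜ
    simp only [Set.mem_compl_iff, mem_ball, dist_zero_right, not_lt, mem_closedBall, not_le] at hx ⊢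
    have : δ ≤ (R' - R) / 2 := min_le_right _ _
    linarith
  refine ⟨⟨φ, hφs, hφc, hφt⟩, ?_, fun hpos x => ?_⟩
  swap
  · exact integral_nonneg fun h => mul_nonneg (hρ0 h) (hpos _)
  change fracNorm s (fun x => φ x - u x) ≤ ε
  rw [fracNorm_eq (hφs.continuous.measurable.fun_sub hu)]
  have hdm : Measurable (fun h => (ρ h).toNNReal) := hρc.measurable.real_toNNReal
  set ν : Measure (EuclideanSpace ℝ (Fin N)) :=
    volume.withDensity (fun h => ((ρ h).toNNReal : ℝ≥0∞)) with hν
  have hsm : ∀ h (t : ℝ), (ρ h).toNNReal • t = ρ h • t := fun h t => by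
    rw [NNReal.smul_def, Real.coe_toNNReal _ (hρ0 h)]
  have hprob : IsProbabilityMeasure ν := ⟨by
    rw [hν, withDensity_apply _ MeasurableSet.univ, Measure.restrict_univ]
    change ∫⁻ h, ENNReal.ofReal (ρ h) = 1
    rw [← ofReal_integral_eq_lintegral_ofReal hρi (Eventually.of_forall hρ0), hρ,
      b.integral_normed, ENNReal.ofReal_one]⟩
  have hνi : ∀ x, Integrable (fun h => u (x - h)) ν := fun x => by
    rw [hν, integrable_withDensity_iff_integrable_smul hdm]
    simpa only [hsm] using hex x
  have hνφ : ∀ x, ∫ h, u (x - h) ∂ν = φ x := fun x => by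
    rw [hν, integral_withDensity_eq_integral_smul hdm]
    simp only [hsm, hφ]
  have hνb : ∀ᵐ h ∂ν, h ∈ ball (0 : EuclideanSpace ℝ (Fin N)) δ₀ := by
    rw [hν, ae_withDensity_iff hdm.coe_nnreal_ennreal]
    refine Eventually.of_forall fun h hh => ?_
    have h1 : ρ h ≠ 0 := fun h0 => hh (by simp [h0])
    simpa using (hρs h h1).trans_le (min_le_left _ _)
  have key : fracQuot s (fun x => φ x - u x) = fun p => ∫ h,
      (fracQuot s u ((1 : ℝ) • p + (-h, -h)) - fracQuot s u p) ∂ν := by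
    ext p
    have e : ∀ h, fracQuot s u ((1 : ℝ) • p + (-h, -h)) - fracQuot s u p =
        ((u (p.1 - h) - u (p.2 - h)) - (u p.1 - u p.2)) /
          ‖p.1 - p.2‖ ^ (((N : ℝ) + 2 * s) / 2) := fun h => by
      simp only [fracQuot, one_smul, Prod.fst_add, Prod.snd_add, ← sub_eq_add_neg,
        sub_sub_sub_cancel_right]
      ring
    simp only [e]
    have hi : Integrable (fun h => u (p.1 - h) - u (p.2 - h)) ν := (hνi _).sub (hνi _)
    rw [integral_div, integral_sub hi (integrable_const _),
      integral_sub (hνi _) (hνi _), hνφ, hνφ]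
    simp only [integral_const, probReal_univ, one_smul, fracQuot]
    ring
  rw [key]
  refine eLpNorm_two_integral_le ?_ ?_
  · have hm := measurable_fracQuot (s := s) hu
    refine (hm.comp (g := fracQuot s u) ?_).sub (hm.comp measurable_fst)
    fun_prop
  · filter_upwards [hνb] with h hh using hball h hh

/-- Cut-off at infinity. -/
theorem fracApproximable_of_memLp_two {R R' : ℝ} (hN : 0 < N) (hs0 : 0 < s) (hs1 : s < 1)
    (hR : R < R') (hu : Measurable u) (hu2 : MemLp u 2 volume)
    (hE : MemLp (fracQuot s u) 2 volume) (hu0 : ∀ x, ‖x‖ < R' → u x = 0) :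
    FracApproximable s R u := by
  -- Equal to 1 up to radius `k + 1` and to 0 beyond `2(k + 1)`; as `k + 1 ≥ 1`, it is 1-Lipschitz
  -- uniformly in `k`.
  let η : ℕ → EuclideanSpace ℝ (Fin N) → ℝ := fun k x => max 0 (min 1 (2 - ‖x‖ / (k + 1)))
  have hη0 : ∀ k x, 0 ≤ η k x := fun k x => le_max_left _ _
  have hη1 : ∀ k x, η k x ≤ 1 := fun k x => max_le zero_le_one (min_le_left _ _)
  have hηm : ∀ k, Measurable (η k) := fun k => by fun_prop
  have hηl : ∀ k x y, |η k x - η k y| ≤ ‖x - y‖ := fun k x y => by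
    have hk : (1 : ℝ) ≤ k + 1 := by simp
    have h1 : |‖x‖ / ((k : ℝ) + 1) - ‖y‖ / (k + 1)| ≤ ‖x - y‖ := by
      rw [← sub_div, abs_div, abs_of_pos (by linarith : (0 : ℝ) < k + 1)]
      exact (div_le_self (abs_nonneg _) hk).trans (abs_norm_sub_norm_le x y)
    refine le_trans ?_ h1
    simp only [η]
    generalize ‖x‖ / ((k : ℝ) + 1) = a
    generalize ‖y‖ / ((k : ℝ) + 1) = c
    rw [abs_sub_comm a c]
    refine (abs_max_sub_max_le_max _ _ _ _).trans (max_le (by simp) ?_)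
    refine (abs_min_sub_min_le_max _ _ _ _).trans (max_le (by simp) ?_)
    rw [show 2 - a - (2 - c) = c - a by ring]
  have hηb : ∀ k x y, (η k x - η k y) ^ 2 ≤ min 1 ‖x - y‖ ^ 2 := fun k x y => by
    refine sq_le_sq' ?_ ?_ <;>
    · have := abs_le.1 (hηl k x y)
      have := hη0 k x; have := hη0 k y; have := hη1 k x; have := hη1 k y
      rcases min_cases 1 ‖x - y‖ with h | h <;> linarith
  have hηlim : ∀ x, ∀ᶠ k in atTop, η k x = 1 := fun x => by
    filter_upwards [eventually_ge_atTop ⌈‖x‖⌉₊] with k hk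
    have h1 : ‖x‖ / ((k : ℝ) + 1) ≤ 1 := by
      rw [div_le_one (by positivity)]
      exact (Nat.ceil_le.1 hk).trans (by linarith)
    simp only [η]
    rw [min_eq_left (by linarith), max_eq_right zero_le_one]
  let v : ℕ → EuclideanSpace ℝ (Fin N) → ℝ := fun k x => η k x * u x
  have hvm : ∀ k, Measurable (v k) := fun k => (hηm k).mul hu
  have hlim : Tendsto (fun k => eLpNorm (fracQuot s (fun x => v k x - u x)) 2 volume) atTop
      (𝓝 0) := by
    let K : EuclideanSpace ℝ (Fin N) → ℝ≥0∞ := fun z =>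
      ENNReal.ofReal (min 1 ‖z‖ ^ 2 / ‖z‖ ^ ((N : ℝ) + 2 * s))
    have hK : Measurable K := by fun_prop
    refine tendsto_eLpNorm_two_of_dominated
      (fun p => 2 * ‖fracQuot s u p‖ₑ ^ 2 + 2 * (‖u p.2‖ₑ ^ 2 * K (p.1 - p.2)))
      (Eventually.of_forall fun k => (measurable_fracQuot ((hvm k).fun_sub hu)).aestronglyMeasurable)
      (Eventually.of_forall fun k => Eventually.of_forall fun p => ?_) ?_
      (Eventually.of_forall fun p => ?_)
    · have hsq : ∀ t : ℝ, ‖t‖ₑ ^ 2 = ENNReal.ofReal (t ^ 2) := fun t => by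
        rw [← ofReal_norm, ← ENNReal.ofReal_pow (norm_nonneg _), Real.norm_eq_abs, sq_abs]
      have hle : ∀ a b c d : ℝ, 0 ≤ a → 0 ≤ b → 0 ≤ c → d ≤ 2 * a + 2 * (b * c) →
          ENNReal.ofReal d ≤ 2 * ENNReal.ofReal a + 2 * (ENNReal.ofReal b * ENNReal.ofReal c) := by
        intro a b c d ha hb hc hd
        rw [← ENNReal.ofReal_mul hb, ← mul_add, ← ENNReal.ofReal_add ha (by positivity),
          ← ENNReal.ofReal_ofNat, ← ENNReal.ofReal_mul (by norm_num)]
        exact ENNReal.ofReal_le_ofReal (by linarith)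
      simp only [hsq, K]
      refine hle _ _ _ _ (by positivity) (by positivity) (by positivity) ?_
      rw [← rpow_half_sq (norm_nonneg (p.1 - p.2))]
      set d := ‖p.1 - p.2‖ ^ (((N : ℝ) + 2 * s) / 2)
      have e : fracQuot s (fun x => v k x - u x) p =
          (η k p.1 - 1) * fracQuot s u p + u p.2 * (η k p.1 - η k p.2) / d := by
        simp only [fracQuot, v, d]; ring
      have h3 : ((η k p.1 - 1) * fracQuot s u p) ^ 2 ≤ fracQuot s u p ^ 2 := by
        rw [mul_pow]
        refine mul_le_of_le_one_left (sq_nonneg _) ?_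
        have := hη0 k p.1; have := hη1 k p.1
        nlinarith
      have h4 : (u p.2 * (η k p.1 - η k p.2) / d) ^ 2 ≤
          u p.2 ^ 2 * (min 1 ‖p.1 - p.2‖ ^ 2 / d ^ 2) := by
        rw [div_pow, mul_pow, mul_div_assoc]
        exact mul_le_mul_of_nonneg_left
          (div_le_div_of_nonneg_right (hηb k p.1 p.2) (sq_nonneg _)) (sq_nonneg _)
      rw [e]
      refine add_sq_le.trans ?_
      linarith
    · have hF := ((measurable_fracQuot (s := s) hu).enorm.pow_const 2)
      rw [lintegral_add_left (hF.const_mul 2), lintegral_const_mul _ hF, ← eLpNorm_two_sq,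
        lintegral_const_mul _ (by fun_prop), Measure.volume_eq_prod,
        lintegral_prod_symm' _ (by fun_prop)]
      have : ∀ y, ∫⁻ x, ‖u y‖ₑ ^ 2 * K (x - y) = ‖u y‖ₑ ^ 2 * ∫⁻ z, K z := fun y => by
        rw [lintegral_const_mul _ (by fun_prop), lintegral_sub_right_eq_self K y]
      simp only [this]
      rw [lintegral_mul_const _ (by fun_prop), ← eLpNorm_two_sq]
      have h1 := hE.eLpNorm_ne_top
      have h2 := hu2.eLpNorm_ne_top
      have h3 : ∫⁻ z, K z ≠ ∞ := lintegral_min_sq_div_rpow_ne_top hN hs0 hs1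
      rw [Measure.volume_eq_prod] at h1
      finiteness
    · refine tendsto_const_nhds.congr' ?_
      filter_upwards [hηlim p.1, hηlim p.2] with k h1 h2
      simp [fracQuot, v, h1, h2]
  refine FracApproximable.of_tendsto hu (v := v) hvm ?_
    (fun h n x => mul_nonneg (hη0 n x) (h x)) ?_
  -- Any finite bound would do: it shows that `v k - u`, hence `v k`, has finite energy.
  · filter_upwards [ENNReal.tendsto_nhds_zero.1 hlim 1 one_pos] with k hk
    refine fracApproximable_of_compactSupport (M := 2 * (k + 1)) hR (hvm k) ?_ ?_ ?_ ?_
    · refine hu2.mono (hvm k).aestronglyMeasurable (Eventually.of_forall fun x => ?_)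
      simp only [v, norm_mul, Real.norm_eq_abs, abs_of_nonneg (hη0 k x)]
      exact mul_le_of_le_one_left (abs_nonneg _) (hη1 k x)
    · have h1 : MemLp (fracQuot s (fun x => v k x - u x)) 2 volume :=
        ⟨(measurable_fracQuot ((hvm k).fun_sub hu)).aestronglyMeasurable,
          hk.trans_lt ENNReal.one_lt_top⟩
      refine (h1.add hE).congr_norm (measurable_fracQuot (hvm k)).aestronglyMeasurable
        (Eventually.of_forall fun p => ?_)
      simp [fracQuot_sub]
    · intro x hx; simp [v, hu0 x hx]
    · intro x hx
      have h1 : 2 ≤ ‖x‖ / ((k : ℝ) + 1) := by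
        rw [le_div_iff₀ (by positivity)]; linarith
      simp only [v, η]
      rw [max_eq_left ((min_le_right _ _).trans (by linarith)), zero_mul]
  · simpa only [fracNorm_eq ((hvm _).fun_sub hu)] using hlim

/-- Dilation away from the ball. -/
theorem fracApproximable_of_eq_zero_on_ball {R : ℝ} (hN : 0 < N) (hs0 : 0 < s) (hs1 : s < 1)
    (hR : 0 < R) (hu : Measurable u) (hu2 : MemLp u 2 volume)
    (hE : MemLp (fracQuot s u) 2 volume) (hu0 : ∀ x, ‖x‖ < R → u x = 0) :
    FracApproximable s R u := by
  -- The shift by 2 keeps `c 0` positive.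
  let c : ℕ → ℝ := fun n => 1 - 1 / ((n : ℝ) + 2)
  have hc1 : ∀ n, c n < 1 := fun n => by
    have : 0 < 1 / ((n : ℝ) + 2) := by positivity
    simp only [c]; linarith
  have hc0 : ∀ n, 0 < c n := fun n => by
    have : 1 / ((n : ℝ) + 2) < 1 := by
      rw [div_lt_one (by positivity)]; linarith [(Nat.cast_nonneg n : (0 : ℝ) ≤ n)]
    simp only [c]; linarith
  have hc : Tendsto c atTop (𝓝 1) := by
    have h : Tendsto (fun n : ℕ => 1 / ((n : ℝ) + 2)) atTop (𝓝 0) :=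
      tendsto_const_nhds.div_atTop
        (tendsto_atTop_add_const_right _ _ tendsto_natCast_atTop_atTop)
    simpa only [sub_zero] using h.const_sub 1
  let a : ℝ := ((N : ℝ) + 2 * s) / 2
  let v : ℕ → EuclideanSpace ℝ (Fin N) → ℝ := fun n x => u (c n • x)
  have hvm : ∀ n, Measurable (v n) := fun n => hu.comp (by fun_prop)
  -- Used only to see that `v n` is eventually in `L²`.
  have hL2 := tendsto_eLpNorm_comp_affine_sub hc
    (a := fun _ => (0 : EuclideanSpace ℝ (Fin N))) tendsto_const_nhds hu2
  have hLE := tendsto_eLpNorm_comp_affine_sub hc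
    (a := fun _ => (0 : EuclideanSpace ℝ (Fin N) × EuclideanSpace ℝ (Fin N)))
    tendsto_const_nhds hE
  simp only [add_zero] at hL2 hLE
  have hq : ∀ n, fracQuot s (fun x => v n x - u x) =
      c n ^ a • (fun p => fracQuot s u (c n • p) - fracQuot s u p) +
        (c n ^ a - 1) • fracQuot s u := fun n => by
    ext p
    have h1 : fracQuot s (v n) p = c n ^ a * fracQuot s u (c n • p) := by
      have h0 : c n ^ a ≠ 0 := (Real.rpow_pos_of_pos (hc0 n) a).ne'
      simp only [fracQuot, v, Prod.smul_fst, Prod.smul_snd, ← smul_sub, norm_smul,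
        Real.norm_eq_abs, abs_of_pos (hc0 n)]
      rw [Real.mul_rpow (hc0 n).le (norm_nonneg _), ← mul_div_assoc, mul_div_mul_left _ _ h0]
    simp only [fracQuot_sub, h1, Pi.add_apply, Pi.smul_apply, smul_eq_mul]
    ring
  have hca : Tendsto (fun n => c n ^ a) atTop (𝓝 1) := by
    simpa using hc.rpow_const (p := a) (Or.inl one_ne_zero)
  have hlim : Tendsto (fun n => eLpNorm (fracQuot s (fun x => v n x - u x)) 2 volume) atTop
      (𝓝 0) := by
    have hup : Tendsto (fun n => ‖c n ^ a‖ₑ * eLpNorm (fun p => fracQuot s u (c n • p) -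
        fracQuot s u p) 2 volume + ‖c n ^ a - 1‖ₑ * eLpNorm (fracQuot s u) 2 volume) atTop
        (𝓝 0) := by
      have h1 := ENNReal.Tendsto.mul hca.enorm (Or.inr (by simp)) hLE (Or.inr (by simp))
      have h2 := ENNReal.Tendsto.mul_const (hca.sub_const 1).enorm
        (Or.inr hE.eLpNorm_ne_top)
      simpa using h1.add h2
    refine tendsto_of_tendsto_of_tendsto_of_le_of_le tendsto_const_nhds hup
      (fun _ => zero_le) fun n => ?_
    have hm := measurable_fracQuot (s := s) hu
    have hm' : Measurable fun p => fracQuot s u (c n • p) := hm.comp (by fun_prop)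
    rw [hq, ← eLpNorm_const_smul, ← eLpNorm_const_smul]
    exact eLpNorm_add_le ((hm'.sub hm).const_smul _).aestronglyMeasurable
      (hm.const_smul _).aestronglyMeasurable (by norm_num)
  refine FracApproximable.of_tendsto hu (v := v) hvm ?_ (fun h n x => h _) ?_
  · filter_upwards [ENNReal.tendsto_nhds_zero.1 hlim 1 one_pos,
      ENNReal.tendsto_nhds_zero.1 hL2 1 one_pos] with n hn hn2
    refine fracApproximable_of_memLp_two (R' := R / c n) hN hs0 hs1 ?_ (hvm n) ?_ ?_ ?_
    · rw [lt_div_iff₀ (hc0 n)]; nlinarith [hc1 n]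
    · have h1 : MemLp (fun x => v n x - u x) 2 volume :=
        ⟨((hvm n).fun_sub hu).aestronglyMeasurable, hn2.trans_lt ENNReal.one_lt_top⟩
      refine (h1.add hu2).congr_norm (hvm n).aestronglyMeasurable
        (Eventually.of_forall fun p => ?_)
      simp
    · have h1 : MemLp (fracQuot s (fun x => v n x - u x)) 2 volume :=
        ⟨(measurable_fracQuot ((hvm n).fun_sub hu)).aestronglyMeasurable,
          hn.trans_lt ENNReal.one_lt_top⟩
      refine (h1.add hE).congr_norm (measurable_fracQuot (hvm n)).aestronglyMeasurable
        (Eventually.of_forall fun p => ?_)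
      simp [fracQuot_sub]
    · intro x hx
      rw [lt_div_iff₀ (hc0 n)] at hx
      refine hu0 _ ?_
      rw [norm_smul, Real.norm_eq_abs, abs_of_pos (hc0 n)]
      linarith
  · simpa only [fracNorm_eq ((hvm _).fun_sub hu)] using hlim

/-- Removal of the small values. -/
theorem fracApproximable_of_memLp {R : ℝ} {q : ℝ≥0∞} (hq2 : 2 ≤ q) (hq : q ≠ ∞) (hN : 0 < N)
    (hs0 : 0 < s) (hs1 : s < 1) (hR : 0 < R) (hu : Measurable u) (huq : MemLp u q volume)
    (hE : MemLp (fracQuot s u) 2 volume) (hu0 : ∀ x, ‖x‖ < R → u x = 0) :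
    FracApproximable s R u := by
  let e : ℕ → ℝ := fun n => 1 / ((n : ℝ) + 1)
  have he0 : ∀ n, 0 < e n := fun n => by positivity
  have he : Tendsto e atTop (𝓝 0) := tendsto_one_div_add_atTop_nhds_zero_nat
  -- Clipping to `[-e n, e n]` is 1-Lipschitz, so the quotient of `T n ∘ u` is dominated by that of
  -- `u`.
  let T : ℕ → ℝ → ℝ := fun n t => max (-e n) (min (e n) t)
  have hT : ∀ n t, |T n t| ≤ e n := fun n t =>
    abs_le.2 ⟨le_max_left _ _, max_le (by linarith [he0 n]) (min_le_left _ _)⟩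
  have hTl : ∀ n t r, |T n t - T n r| ≤ |t - r| := fun n t r => by
    refine (abs_max_sub_max_le_max _ _ _ _).trans (max_le (by simp) ?_)
    exact (abs_min_sub_min_le_max _ _ _ _).trans (max_le (by simp) le_rfl)
  have hT0 : ∀ n t, |t| ≤ e n → T n t = t := fun n t ht => by
    simp only [T]
    rw [min_eq_right (abs_le.1 ht).2, max_eq_right (abs_le.1 ht).1]
  have hTle : ∀ n t, 0 ≤ t → T n t ≤ t := fun n t ht =>
    max_le (by linarith [he0 n]) (min_le_right _ _)
  let v : ℕ → EuclideanSpace ℝ (Fin N) → ℝ := fun n x => u x - T n (u x)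
  have hTm : ∀ n, Measurable (fun x => T n (u x)) := fun n => by fun_prop
  have hvm : ∀ n, Measurable (v n) := fun n => hu.sub (hTm n)
  have hqT : ∀ n p, |fracQuot s (fun x => T n (u x)) p| ≤ |fracQuot s u p| := fun n p => by
    simp only [fracQuot, abs_div]
    exact div_le_div_of_nonneg_right (hTl _ _ _) (abs_nonneg _)
  have hqE : ∀ n, MemLp (fracQuot s (fun x => T n (u x))) 2 volume := fun n =>
    hE.mono (measurable_fracQuot (hTm n)).aestronglyMeasurable (Eventually.of_forall (hqT n))
  have hv : ∀ n, (fun x => v n x - u x) = fun x => -T n (u x) := fun n => by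
    ext x; simp [v]
  have hneg : ∀ n p, fracQuot s (fun x => -T n (u x)) p = -fracQuot s (fun x => T n (u x)) p :=
    fun n p => by simp only [fracQuot]; ring
  refine FracApproximable.of_tendsto hu (v := v) hvm (Eventually.of_forall fun n => ?_)
    (fun h n x => sub_nonneg.2 (hTle n _ (h x))) ?_
  · refine fracApproximable_of_eq_zero_on_ball hN hs0 hs1 hR (hvm n) ?_ ?_ ?_
    · have hvq : MemLp (v n) q volume := by
        refine (huq.const_mul 2).mono (hvm n).aestronglyMeasurable
          (Eventually.of_forall fun x => ?_)
        have h1 := hTl n (u x) 0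
        rw [hT0 n 0 (by simpa using (he0 n).le), sub_zero, sub_zero] at h1
        have h2 := abs_sub (u x) (T n (u x))
        simp only [v, Real.norm_eq_abs, abs_mul, Nat.abs_ofNat]
        linarith
      -- `v n` vanishes off `{|u| ≥ e n}`, of finite measure by Chebyshev's inequality; there `L^q`
      -- embeds in `L²`.
      have hfin := huq.meas_ge_lt_top (ε := (e n).toNNReal) (by positivity) hq
        (by simpa using he0 n)
      refine hvq.mono_exponent_of_measure_support_ne_top (fun x hx => ?_) hfin.ne hq2
      rw [Set.mem_ofPred_eq, not_le, ← NNReal.coe_lt_coe, Real.coe_toNNReal _ (he0 n).le,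
        coe_nnnorm, Real.norm_eq_abs] at hx
      simp only [v]
      rw [hT0 n _ hx.le, sub_self]
    · refine (hE.sub (hqE n)).congr_norm (measurable_fracQuot (hvm n)).aestronglyMeasurable
        (Eventually.of_forall fun p => ?_)
      simp only [v, fracQuot_sub, Pi.sub_apply]
    · intro x hx
      simp only [v]
      rw [hu0 x hx, hT0 n 0 (by simpa using (he0 n).le), sub_self]
  · simp only [hv, fracNorm_eq (hTm _).fun_neg]
    refine tendsto_eLpNorm_two_of_dominated (fun p => ‖fracQuot s u p‖ₑ ^ 2)
      (Eventually.of_forall fun n => (measurable_fracQuot (hTm n).fun_neg).aestronglyMeasurable)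
      (Eventually.of_forall fun n => Eventually.of_forall fun p => ?_) ?_
      (Eventually.of_forall fun p => ?_)
    · gcongr
      rw [hneg, enorm_neg, enorm_le_iff_norm_le]
      exact hqT n p
    · rw [← eLpNorm_two_sq]
      exact ENNReal.pow_ne_top hE.eLpNorm_ne_top
    · have hz : ∀ t, Tendsto (fun n => T n t) atTop (𝓝 0) := fun t =>
        squeeze_zero_norm (fun n => hT n t) he
      have := ((hz (u p.1)).neg.sub (hz (u p.2)).neg).div_const
        (‖p.1 - p.2‖ ^ (((N : ℝ) + 2 * s) / 2))
      simpa [fracQuot] using this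

end

/-! ### The approximation theorem -/

theorem proposition5p4 (N : ℕ) (s R : ℝ) (hs0 : 0 < s) (hs1 : s < 1) (hN : 2 * s < (N : ℝ))
    (hR : 0 < R) (u : EuclideanSpace ℝ (Fin N) → ℝ) (hu : MemFracSobolev s u)
    (hu0 : ∀ᵐ x ∂volume, x ∈ ball (0 : EuclideanSpace ℝ (Fin N)) R → u x = 0) :
    ∃ φ : ℕ → TestFunction (ballExterior N R) ℝ (⊤ : ℕ∞),
      (∀ n, MemFracSobolev s (φ n)) ∧
      Tendsto (fun n => fracNorm s (fun x => φ n x - u x)) atTop (𝓝 0) ∧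
      ((∀ᵐ x ∂volume, 0 ≤ u x) → ∀ n x, 0 ≤ φ n x) := by
  have hNpos : 0 < N := by
    have : (0 : ℝ) < N := by linarith
    exact_mod_cast this
  have hq2 : 2 ≤ fracCritExp N s := by
    rw [fracCritExp, ← ENNReal.ofReal_ofNat]
    refine ENNReal.ofReal_le_ofReal ?_
    rw [le_div_iff₀ (by linarith)]; linarith
  obtain ⟨w, hwm, hwu, hw0, hwpos⟩ : ∃ w : EuclideanSpace ℝ (Fin N) → ℝ, Measurable w ∧
      w =ᵐ[volume] u ∧ (∀ x, ‖x‖ < R → w x = 0) ∧ ((∀ᵐ x ∂volume, 0 ≤ u x) → ∀ x, 0 ≤ w x) := by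
    obtain ⟨g, hg, hug⟩ : ∃ g : EuclideanSpace ℝ (Fin N) → ℝ, Measurable g ∧ u =ᵐ[volume] g :=
      hu.1.1.aemeasurable
    -- `FracApproximable` asks for the sign at every point, so for `u ≥ 0` a.e. the representative
    -- is built from `|g|`.
    by_cases hpos : ∀ᵐ x ∂volume, 0 ≤ u x
    · refine ⟨(ball 0 R)ᶜ.indicator fun x => |g x|,
        hg.abs.indicator measurableSet_ball.compl, ?_, fun x hx => ?_,
        fun _ x => Set.indicator_nonneg (fun _ _ => abs_nonneg _) x⟩
      · filter_upwards [hug, hu0, hpos] with x h1 h2 h3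
        by_cases hx : x ∈ ball (0 : EuclideanSpace ℝ (Fin N)) R
        · simp [hx, h2 hx]
        · rw [Set.indicator_of_mem hx, ← h1, abs_of_nonneg h3]
      · simp [hx]
    · refine ⟨(ball 0 R)ᶜ.indicator g, hg.indicator measurableSet_ball.compl, ?_,
        fun x hx => ?_, fun h => absurd h hpos⟩
      · filter_upwards [hug, hu0] with x h1 h2
        by_cases hx : x ∈ ball (0 : EuclideanSpace ℝ (Fin N)) R
        · simp [hx, h2 hx]
        · rw [Set.indicator_of_mem hx, ← h1]
      · simp [hx]
  have hwE : MemLp (fracQuot s w) 2 volume := by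
    rw [memLp_fracQuot_iff hwm, gagliardoEnergy_congr_ae hwu]
    exact hu.2
  have happ : FracApproximable s R w :=
    fracApproximable_of_memLp hq2 ENNReal.ofReal_ne_top hNpos hs0 hs1 hR hwm
      (hu.1.ae_eq hwu.symm) hwE hw0
  choose φ hφ hφ0 using fun n : ℕ => happ (n + 1 : ℝ≥0∞)⁻¹ (by simp)
  refine ⟨φ, fun n => ⟨(φ n).continuous.memLp_of_hasCompactSupport (φ n).hasCompactSupport, ?_⟩,
    ?_, fun h n => hφ0 n (hwpos h)⟩
  · have hφm : Measurable (φ n) := (φ n).continuous.measurable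
    have hd := hφ n
    rw [fracNorm_eq (hφm.fun_sub hwm)] at hd
    have h1 : MemLp (fracQuot s (fun x => φ n x - w x)) 2 volume :=
      ⟨(measurable_fracQuot (hφm.fun_sub hwm)).aestronglyMeasurable,
        hd.trans_lt (by simp)⟩
    rw [← memLp_fracQuot_iff hφm]
    refine (h1.add hwE).congr_norm (measurable_fracQuot hφm).aestronglyMeasurable
      (Eventually.of_forall fun p => ?_)
    simp [fracQuot_sub]
  · have hn : ∀ n, fracNorm s (fun x => φ n x - u x) = fracNorm s (fun x => φ n x - w x) :=
      fun n => fracNorm_congr_ae (by filter_upwards [hwu] with x hx; rw [hx])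
    simp only [hn]
    refine tendsto_of_tendsto_of_tendsto_of_le_of_le tendsto_const_nhds ?_
      (fun _ => zero_le) hφ
    have := (tendsto_add_atTop_iff_nat 1).2 ENNReal.tendsto_inv_nat_nhds_zero
    simpa using this
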